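/- Let $L$ be a real vector space (of arbitrary, possibly infinite, dimension) with a bilinear map $[\cdot,\cdot]:L\times L\to\mathbb{R}$ such that the antisymmetric form $\omega(\xi,\xi')=\frac12[\xi,\xi']-\frac12[\xi',\xi]$ is non-degenerate (if $\omega(\xi,\xi')=0$ for all $\xi'$ then $\xi=0$). Put $M=\{\tau\in L:[\xi,\tau]=0\ \forall\xi\in L\}$ and $N=\{\tau\in L:[\tau,\xi]=0\ \forall\xi\in L\}$, and assume $M+N=L$. Let $Q=L/M$ with quotient map $q:L\to Q$; the map $[\cdot,\cdot]$ descends to $L\times Q\to\mathbb{R}$. Let $\Omega:Q\times Q\to\mathbb{C}$ be a symmetric real-bilinear form with positive definite real part that is admissible, i.e.: $Q$ with the inner product $\mathrm{Re}\,\Omega$ is a real separable Hilbert space; $\mathrm{Im}\,\Omega$ is continuous for its topology; for every $\xi\in L$ the map $\phi\mapsto[\xi,\phi]$ is continuous on $Q$; and every continuous linear map $Q\to\mathbb{R}$ is of the form $\phi\mapsto[\xi,\phi]$ for some $\xi\in L$. Let $Q^*$ be the topological dual of $Q$ and let $\hat Q$ be the algebraic dual of $Q^*$, with the $\sigma$-algebra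 generated by the evaluations $\Phi\mapsto\Phi(l)$, $l\in Q^*$. For each closed subspace $W\subseteq Q$ of finite codimension there is a canonical projection $p_W:\hat Q\to Q/W$, characterized by $m(p_W(\Phi))=\Phi(m\circ\pi_W)$ for all linear $m:Q/W\to\mathbb{R}$, where $\pi_W:Q\to Q/W$ is the quotient map. Then there is a unique measure $\nu_Q$ on $\hat Q$ such that, for every such $W$, the image of $\nu_Q$ under $p_W$ is the probability measure $\exp(-\|x\|^2)\,\mathrm{d}\mu_W(x)$, where $\|\cdot\|$ is the quotient norm on $Q/W$ and $\mu_W$ is the suitably normalized Lebesgue measure. Let $\mathcal{H}^{\tilde S}=L^2(\hat Q,\nu_Q)$ (complex-valued functions). For $\tau\in L$ the reduced wave function of the (normalized) coherent state, $$k_\tau(\phi)=\exp\left(\Omega(q(\tau),\phi)+\mathrm{i}[\tau,\phi]-\tfrac12\Omega(q(\tau),q(\tau))-\tfrac{\mathrm{i}}2[\tau,\tau]\right),\qquad \phi\in Q,$$ is cylindrical, i.e. induced from a function on some quotient $Q/W$ as above, and hence extends canonically, via $p_W$, to a function on $\hat Q$; the extension is obtained by evaluating $\Phi\in\hat Q$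 on the continuous linear functionals $\mathrm{Re}\,\Omega(q(\tau),\cdot)$ and $\mathrm{Im}\,\Omega(q(\tau),\cdot)+[\tau,\cdot]$ in the exponent. These extensions belong to $L^2(\hat Q,\nu_Q)$ for all $\tau\in L$, and their complex linear span is dense in $\mathcal{H}^{\tilde S}=L^2(\hat Q,\nu_Q)$. -/

import Mathlib

open MeasureTheory

noncomputable section

/-! ### Linear field theory -/

/-- A linear field theory on the real vector space `L` of solutions: a bilinear symplectic
potential `[·,·]` whose symplectic form `ω(ξ,ξ') = ½[ξ,ξ'] - ½[ξ',ξ]` is non-degenerate, and such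
that the subspaces `M = {τ | ∀ ξ, [ξ,τ] = 0}` and `N = {τ | ∀ ξ, [τ,ξ] = 0}` generate `L`. -/
structure LinearFieldTheory (L : Type*) [AddCommGroup L] [Module ℝ L] where
  /-- the symplectic potential `[ξ,τ]` -/
  pot : L →ₗ[ℝ] L →ₗ[ℝ] ℝ
  nondegenerate : ∀ ξ : L,
    (∀ ξ' : L, (1 / 2 : ℝ) * pot ξ ξ' - (1 / 2 : ℝ) * pot ξ' ξ = 0) → ξ = 0
  generate : LinearMap.ker pot.flip ⊔ LinearMap.ker pot = ⊤

namespace LinearFieldTheory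

variable {L : Type*} [AddCommGroup L] [Module ℝ L] (S : LinearFieldTheory L)

/-- `M = {τ | ∀ ξ, [ξ,τ] = 0}`. -/
abbrev M : Submodule ℝ L := LinearMap.ker S.pot.flip

/-- The potential as a map `L × L/M → ℝ`. -/
def potQ (ξ : L) : (L ⧸ S.M) →ₗ[ℝ] ℝ :=
  S.M.liftQ (S.pot ξ) fun _ hτ => LinearMap.congr_fun (LinearMap.mem_ker.1 hτ) ξ

/-- A symmetric bilinear form `Ω : Q × Q → ℂ` on `Q = L/M` with positive definite real part. -/
structure VacuumForm where
  /-- the bilinear form -/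
  Om : (L ⧸ S.M) →ₗ[ℝ] (L ⧸ S.M) →ₗ[ℝ] ℂ
  symm : ∀ φ φ', Om φ φ' = Om φ' φ
  re_pos : ∀ φ, φ ≠ 0 → 0 < (Om φ φ).re

namespace VacuumForm

variable {S} (V : S.VacuumForm)

/-- The configuration space `Q = L/M`, to be endowed with the inner product `Re Ω`. -/
def Q (_V : S.VacuumForm) : Type _ := L ⧸ S.M

instance instAddCommGroupQ : AddCommGroup V.Q := inferInstanceAs (AddCommGroup (L ⧸ S.M))

instance instModuleQ : Module ℝ V.Q := inferInstanceAs (Module ℝ (L ⧸ S.M))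

/-- The real part of `Ω` as an inner product on `Q`. -/
@[reducible]
def core : InnerProductSpace.Core ℝ V.Q where
  inner φ φ' := (V.Om φ φ').re
  conj_inner_symm φ φ' := by
    exact congrArg Complex.re (V.symm φ' φ)
  re_inner_nonneg φ := by
    change 0 ≤ (V.Om φ φ).re
    by_cases h : φ = 0
    · have h0 : V.Om φ φ = 0 := by rw [h]; exact LinearMap.map_zero₂ V.Om _
      rw [h0]; simp
    · exact (V.re_pos φ h).le
  add_left φ χ ψ := by
    have h : V.Om (φ + χ) ψ = V.Om φ ψ + V.Om χ ψ := LinearMap.map_add₂ V.Om φ χ ψ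
    rw [h, Complex.add_re]
  smul_left φ ψ r := by
    have h : V.Om (r • φ) ψ = r • V.Om φ ψ := LinearMap.map_smul₂ V.Om r φ ψ
    rw [h, Complex.smul_re]
    rfl
  definite φ h := by
    by_contra h0
    exact (V.re_pos φ h0).ne' h

instance instNormedAddCommGroupQ : NormedAddCommGroup V.Q :=
  @InnerProductSpace.Core.toNormedAddCommGroup ℝ V.Q _ _ _ V.core

instance instInnerProductSpaceQ : InnerProductSpace ℝ V.Q :=
  InnerProductSpace.ofCore V.core.toCore

/-- The quotient map `q : L → Q`. -/
def q : L →ₗ[ℝ] V.Q := S.M.mkQ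

/-- `Ω`, as a form on `Q`. -/
def form : V.Q →ₗ[ℝ] V.Q →ₗ[ℝ] ℂ := V.Om

/-- The functional `φ ↦ [ξ,φ]` on `Q`. -/
def bracket (ξ : L) : V.Q →ₗ[ℝ] ℝ := S.potQ ξ

/-- Admissibility of `Ω`. Topological notions on `Q` refer to the inner product `Re Ω`. -/
structure Admissible : Prop where
  complete : CompleteSpace V.Q
  separable : TopologicalSpace.SeparableSpace V.Q
  im_continuous : Continuous fun p : V.Q × V.Q => (V.form p.1 p.2).im
  bracket_continuous : ∀ ξ : L, Continuous fun φ : V.Q => V.bracket ξ φ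
  bracket_surjective : ∀ l : V.Q →L[ℝ] ℝ, ∃ ξ : L, ∀ φ, l φ = V.bracket ξ φ

end VacuumForm

end LinearFieldTheory

/-! ### The extension `Q̂` and its Gaussian measure -/

section Hat

variable (Q : Type*) [NormedAddCommGroup Q] [NormedSpace ℝ Q]

/-- `Q̂`, the algebraic dual of the topological dual of `Q`. -/
def HatSpace : Type _ := Module.Dual ℝ (Q →L[ℝ] ℝ)

instance HatSpace.instAddCommGroup : AddCommGroup (HatSpace Q) :=
  inferInstanceAs (AddCommGroup (Module.Dual ℝ (Q →L[ℝ] ℝ)))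

instance HatSpace.instModule : Module ℝ (HatSpace Q) :=
  inferInstanceAs (Module ℝ (Module.Dual ℝ (Q →L[ℝ] ℝ)))

variable {Q}

/-- Evaluation of `Φ ∈ Q̂` on a continuous linear functional. -/
def HatSpace.ev (l : Q →L[ℝ] ℝ) (Φ : HatSpace Q) : ℝ :=
  (show Module.Dual ℝ (Q →L[ℝ] ℝ) from Φ) l

/-- The σ-algebra generated by the cylinder sets. -/
instance HatSpace.instMeasurableSpace : MeasurableSpace (HatSpace Q) :=
  ⨆ l : Q →L[ℝ] ℝ, MeasurableSpace.comap (HatSpace.ev l) inferInstance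

/-- The projection of `Q̂` onto a finite-dimensional quotient `Q/W`, i.e. the map dual to
`(Q/W)^* → Q^*`, using that the finite-dimensional space `Q/W` is its own bidual. -/
def HatSpace.proj (W : Submodule ℝ Q) [IsClosed (W : Set Q)] [FiniteDimensional ℝ (Q ⧸ W)]
    (Φ : HatSpace Q) : Q ⧸ W :=
  (Module.evalEquiv ℝ (Q ⧸ W)).symm
    { toFun := fun m => HatSpace.ev ((LinearMap.toContinuousLinearMap m).comp W.mkQL) Φ
      map_add' := fun m m' => by
        have h : (LinearMap.toContinuousLinearMap (m + m')).comp W.mkQL =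
            (LinearMap.toContinuousLinearMap m).comp W.mkQL +
              (LinearMap.toContinuousLinearMap m').comp W.mkQL := by
          ext x; simp
        rw [h]
        exact map_add (show Module.Dual ℝ (Q →L[ℝ] ℝ) from Φ) _ _
      map_smul' := fun r m => by
        have h : (LinearMap.toContinuousLinearMap (r • m)).comp W.mkQL =
            r • (LinearMap.toContinuousLinearMap m).comp W.mkQL := by
          ext x; simp
        rw [h]
        exact map_smul (show Module.Dual ℝ (Q →L[ℝ] ℝ) from Φ) _ _ }

end Hat

/-- The Gaussian probability measure `exp(-‖x‖²) dμ(x)` on a finite-dimensional space, with `μ` the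
Lebesgue measure normalized so that the total mass is one. -/
def normGaussian (E : Type*) [NormedAddCommGroup E] [NormedSpace ℝ E] [FiniteDimensional ℝ E]
    [MeasurableSpace E] [BorelSpace E] : Measure E :=
  (∫⁻ x : E, ENNReal.ofReal (Real.exp (-‖x‖ ^ 2)) ∂Measure.addHaar)⁻¹ •
    (Measure.addHaar : Measure E).withDensity fun x => ENNReal.ofReal (Real.exp (-‖x‖ ^ 2))

/-- `ν` is the projective limit of the Gaussian measures on the finite-dimensional quotients `Q/W`
(with the quotient norm), where `W` runs through the closed subspaces of finite codimension. -/
def IsGaussianLimit {Q : Type*} [NormedAddCommGroup Q] [NormedSpace ℝ Q]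
    (ν : Measure (HatSpace Q)) : Prop :=
  ∀ (W : Submodule ℝ Q) [IsClosed (W : Set Q)] [FiniteDimensional ℝ (Q ⧸ W)],
    letI : MeasurableSpace (Q ⧸ W) := borel (Q ⧸ W)
    haveI : BorelSpace (Q ⧸ W) := ⟨rfl⟩
    ν.map (HatSpace.proj W) = normGaussian (Q ⧸ W)

/-- `F` on `Q̂` is the canonical extension of the cylindrical function `f` on `Q`: both are induced
from the same function on a finite-dimensional quotient. -/
def IsCylindricalExtension {Q : Type*} [NormedAddCommGroup Q] [NormedSpace ℝ Q]
    (f : Q → ℂ) (F : HatSpace Q → ℂ) : Prop :=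
  ∃ (W : Submodule ℝ Q) (_ : IsClosed (W : Set Q)) (_ : FiniteDimensional ℝ (Q ⧸ W))
    (h : Q ⧸ W → ℂ), (∀ φ, f φ = h (W.mkQ φ)) ∧ ∀ Φ, F Φ = h (HatSpace.proj W Φ)

/-! ### Coherent states -/

namespace LinearFieldTheory.VacuumForm

variable {L : Type*} [AddCommGroup L] [Module ℝ L] {S : LinearFieldTheory L} {V : S.VacuumForm}

/-- The reduced wave function of the normalized coherent state associated with `τ ∈ L`,
`k_τ(φ) = exp(Ω(q τ,φ) + i[τ,φ] - ½Ω(q τ,q τ) - (i/2)[τ,τ])`. -/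
def redCoherent (V : S.VacuumForm) (τ : L) (φ : V.Q) : ℂ :=
  Complex.exp (V.form (V.q τ) φ + Complex.I * (V.bracket τ φ : ℂ)
    - (1 / 2 : ℂ) * V.form (V.q τ) (V.q τ) - Complex.I / 2 * (S.pot τ τ : ℂ))

/-- The continuous functional `Re Ω(q τ,·)`. -/
def reL (V : S.VacuumForm) (τ : L) : V.Q →L[ℝ] ℝ := innerSL ℝ (V.q τ)

/-- The continuous functional `Im Ω(q τ,·) + [τ,·]`. -/
def imL (hV : V.Admissible) (τ : L) : V.Q →L[ℝ] ℝ where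
  toLinearMap := Complex.imLm ∘ₗ V.form (V.q τ) + V.bracket τ
  cont := (hV.im_continuous.comp (Continuous.prodMk_right (V.q τ))).add (hV.bracket_continuous τ)

/-- The reduced wave function `k_τ`, canonically extended to `Q̂`: the functional
`Ω(q τ,·) + i[τ,·]` in the exponent is evaluated on `Φ ∈ Q̂`. -/
def redCoherentHat (hV : V.Admissible) (τ : L) (Φ : HatSpace V.Q) : ℂ :=
  Complex.exp ((HatSpace.ev (V.reL τ) Φ : ℂ) + Complex.I * (HatSpace.ev (imL hV τ) Φ : ℂ)
    - (1 / 2 : ℂ) * V.form (V.q τ) (V.q τ) - Complex.I / 2 * (S.pot τ τ : ℂ))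

end LinearFieldTheory.VacuumForm

end

/-!
A measure on `Q̂` is determined by its characteristic functional on `Q^*`, and the Gaussian limit is
the one with characteristic functional `exp (-‖l‖² / 4)`. Such a measure is obtained from an
isonormal Gaussian process over `Q^*`: the process is linear in `l` only up to null sets, but
prescribing its paths on a Hamel basis of `Q^*` makes every path a point of `Q̂`.

Since `L = M + N`, every continuous functional `l` on `Q` is `[τ,·]` for some `τ ∈ M`, where
`q τ = 0` and `[τ,τ] = 0`, so the coherent states of elements of `M` are exactly the characters
`exp (i Φ(l))` of `Q̂`. A square-integrable function orthogonal to all characters is zero, because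
the measures with densities the positive and negative parts of its real part have the same
characteristic functional, and likewise for its imaginary part. Hence already the characters span a
dense subspace.
-/

namespace HatSpace

variable {Q : Type*} [NormedAddCommGroup Q] [NormedSpace ℝ Q]

lemma ev_zero (Φ : HatSpace Q) : ev (0 : Q →L[ℝ] ℝ) Φ = 0 :=
  map_zero (show Module.Dual ℝ (Q →L[ℝ] ℝ) from Φ)

lemma ev_add (l l' : Q →L[ℝ] ℝ) (Φ : HatSpace Q) : ev (l + l') Φ = ev l Φ + ev l' Φ :=
  map_add (show Module.Dual ℝ (Q →L[ℝ] ℝ) from Φ) l l'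

lemma ev_neg (l : Q →L[ℝ] ℝ) (Φ : HatSpace Q) : ev (-l) Φ = -ev l Φ :=
  map_neg (show Module.Dual ℝ (Q →L[ℝ] ℝ) from Φ) l

lemma ev_smul (r : ℝ) (l : Q →L[ℝ] ℝ) (Φ : HatSpace Q) : ev (r • l) Φ = r * ev l Φ :=
  map_smul (show Module.Dual ℝ (Q →L[ℝ] ℝ) from Φ) r l

lemma ev_sum {ι : Type*} (s : Finset ι) (l : ι → Q →L[ℝ] ℝ) (Φ : HatSpace Q) :
    ev (∑ i ∈ s, l i) Φ = ∑ i ∈ s, ev (l i) Φ :=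
  map_sum (show Module.Dual ℝ (Q →L[ℝ] ℝ) from Φ) l s

@[fun_prop]
lemma measurable_ev (l : Q →L[ℝ] ℝ) : Measurable (ev l) :=
  measurable_iff_comap_le.2 <|
    le_iSup (fun l : Q →L[ℝ] ℝ => MeasurableSpace.comap (ev l) inferInstance) l

lemma measurableSpace_eq_comap_ev :
    (instMeasurableSpace : MeasurableSpace (HatSpace Q)) =
      MeasurableSpace.comap (fun Φ l => ev l Φ) MeasurableSpace.pi := by
  rw [MeasurableSpace.pi, MeasurableSpace.comap_iSup]
  simp_rw [MeasurableSpace.comap_comp]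
  rfl

lemma measurable_of_measurable_ev {α : Type*} [MeasurableSpace α] {f : α → HatSpace Q}
    (hf : ∀ l : Q →L[ℝ] ℝ, Measurable fun a => ev l (f a)) : Measurable f := by
  rw [measurable_iff_comap_le, measurableSpace_eq_comap_ev, MeasurableSpace.comap_comp]
  exact (measurable_pi_lambda _ hf).comap_le

section Projection

variable (W : Submodule ℝ Q) [IsClosed (W : Set Q)] [FiniteDimensional ℝ (Q ⧸ W)]

lemma apply_proj (m : (Q ⧸ W) →L[ℝ] ℝ) (Φ : HatSpace Q) :
    m (proj W Φ) = ev (m.comp W.mkQL) Φ :=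
  Module.apply_evalEquiv_symm_apply ℝ _ m.toLinearMap _

lemma measurable_proj [MeasurableSpace (Q ⧸ W)] [BorelSpace (Q ⧸ W)] :
    Measurable (proj W) := by
  let b := Module.finBasis ℝ (Q ⧸ W)
  have proj_eq_sum : proj W = fun Φ =>
      ∑ j, ev ((LinearMap.toContinuousLinearMap (b.coord j)).comp W.mkQL) Φ • b j := by
    ext1 Φ
    simp_rw [← apply_proj, LinearMap.coe_toContinuousLinearMap', b.coord_apply, b.sum_repr]
  have : ProperSpace (Q ⧸ W) := FiniteDimensional.proper_real _
  rw [proj_eq_sum]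
  fun_prop

end Projection

lemma isCylindricalExtension_comp_ev {ι : Type*} [Finite ι] (l : ι → Q →L[ℝ] ℝ)
    (g : (ι → ℝ) → ℂ) :
    IsCylindricalExtension (fun φ => g fun i => l i φ) fun Φ => g fun i => ev (l i) Φ := by
  let f := ContinuousLinearMap.pi l
  let W := LinearMap.ker f.toLinearMap
  have hW : IsClosed (W : Set Q) := f.isClosed_ker
  have finiteDimensional : FiniteDimensional ℝ (Q ⧸ W) :=
    Module.Finite.equiv f.quotKerEquivRange.symm
  let m : ι → (Q ⧸ W) →L[ℝ] ℝ := fun i => LinearMap.toContinuousLinearMap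
    (W.liftQ (l i).toLinearMap fun _ hφ => congr_fun hφ i)
  refine ⟨W, hW, finiteDimensional, fun x => g fun i => m i x, fun φ => rfl, fun Φ => ?_⟩
  simp_rw [apply_proj]
  rfl

/-- The character of `Q̂` with frequency `l ∈ Q^*`. -/
noncomputable def character (l : Q →L[ℝ] ℝ) (Φ : HatSpace Q) : ℂ :=
  Complex.exp (ev l Φ * Complex.I)

lemma norm_character (l : Q →L[ℝ] ℝ) (Φ : HatSpace Q) : ‖character l Φ‖ = 1 :=
  Complex.norm_exp_ofReal_mul_I _

lemma character_neg (l : Q →L[ℝ] ℝ) (Φ : HatSpace Q) :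
    character (-l) Φ = starRingEnd ℂ (character l Φ) := by
  simp [character, ev_neg, ← Complex.exp_conj]

lemma measurable_character (l : Q →L[ℝ] ℝ) : Measurable (character l) := by
  unfold character
  fun_prop

/-- The characteristic functional of a measure on `Q̂`, i.e. its Fourier transform on `Q^*`. -/
noncomputable def charFunctional (μ : Measure (HatSpace Q)) (l : Q →L[ℝ] ℝ) : ℂ :=
  ∫ Φ, character l Φ ∂μ

lemma charFunctional_zero_eq_one_iff {μ : Measure (HatSpace Q)} :
    charFunctional μ 0 = 1 ↔ IsProbabilityMeasure μ := by
  rw [isProbabilityMeasure_iff_real]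
  simp [charFunctional, character, ev_zero]

lemma charFun_map_ev (μ : Measure (HatSpace Q)) (l : Q →L[ℝ] ℝ) (t : ℝ) :
    charFun (μ.map (ev l)) t = charFunctional μ (t • l) := by
  rw [charFun_apply_real, integral_map (by fun_prop) (by fun_prop)]
  simp [charFunctional, character, ev_smul]

lemma charFunDual_map_ev {ι : Type*} [Fintype ι] [DecidableEq ι] (μ : Measure (HatSpace Q))
    (l : ι → Q →L[ℝ] ℝ) (m : StrongDual ℝ (ι → ℝ)) :
    charFunDual (μ.map fun Φ i => ev (l i) Φ) m =
      charFunctional μ (∑ i, m (Pi.single i 1) • l i) := by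
  rw [charFunDual_apply, integral_map (by fun_prop) (by fun_prop), charFunctional]
  congr 1 with Φ
  simp_rw [character, ev_sum, ev_smul]
  congr 3
  conv_lhs => rw [pi_eq_sum_univ' fun i => ev (l i) Φ]
  simp [map_sum, map_smul, mul_comm]

lemma charFunDual_map_proj (μ : Measure (HatSpace Q)) (W : Submodule ℝ Q)
    [IsClosed (W : Set Q)] [FiniteDimensional ℝ (Q ⧸ W)] [MeasurableSpace (Q ⧸ W)]
    [BorelSpace (Q ⧸ W)] (m : StrongDual ℝ (Q ⧸ W)) :
    charFunDual (μ.map (proj W)) m = charFunctional μ (m.comp W.mkQL) := by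
  rw [charFunDual_apply, integral_map (measurable_proj W).aemeasurable (by fun_prop)]
  simp_rw [apply_proj, charFunctional, character]

theorem ext_of_charFunctional {μ ν : Measure (HatSpace Q)} [IsFiniteMeasure μ]
    [IsFiniteMeasure ν] (h : ∀ l, charFunctional μ l = charFunctional ν l) : μ = ν := by
  classical
  have measurable_evPi : Measurable fun (Φ : HatSpace Q) (l : Q →L[ℝ] ℝ) => ev l Φ := by fun_prop
  have map_restrict : ∀ (ρ : Measure (HatSpace Q)) (I : Finset (Q →L[ℝ] ℝ)),
      (ρ.map fun Φ l => ev l Φ).map I.restrict = ρ.map fun Φ (i : I) => ev (i : Q →L[ℝ] ℝ) Φ :=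
    fun ρ I => Measure.map_map (Finset.measurable_restrict I) measurable_evPi
  have map_evPi_eq : (μ.map fun Φ l => ev l Φ) = ν.map fun Φ l => ev l Φ := by
    refine IsProjectiveLimit.unique (map_restrict μ) fun I => (map_restrict ν I).trans ?_
    refine Measure.ext_of_charFunDual (funext fun m => ?_)
    rw [charFunDual_map_ev, charFunDual_map_ev, h]
  ext s hs
  rw [measurableSpace_eq_comap_ev] at hs
  obtain ⟨t, ht, rfl⟩ := hs
  rw [← Measure.map_apply measurable_evPi ht, map_evPi_eq, Measure.map_apply measurable_evPi ht]

end HatSpace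

open Filter Topology

lemma norm_comp_mkQL {Q : Type*} [SeminormedAddCommGroup Q] [NormedSpace ℝ Q]
    (W : Submodule ℝ Q) (m : (Q ⧸ W) →L[ℝ] ℝ) : ‖m.comp W.mkQL‖ = ‖m‖ := by
  refine le_antisymm ?_ ?_
  · refine ContinuousLinearMap.opNorm_le_bound _ (ContinuousLinearMap.opNorm_nonneg _) fun x => ?_
    exact (m.le_opNorm _).trans (by gcongr; exact Submodule.Quotient.norm_mk_le W x)
  · refine ContinuousLinearMap.opNorm_le_bound _ (ContinuousLinearMap.opNorm_nonneg _) fun x => ?_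
    have bound_lift : ∀ ε > 0, ‖m x‖ ≤ ‖m.comp W.mkQL‖ * (‖x‖ + ε) := by
      intro ε hε
      obtain ⟨y, rfl, hy⟩ := Submodule.Quotient.norm_mk_lt x hε
      exact ((m.comp W.mkQL).le_opNorm y).trans (by gcongr)
    have tendsto_bound : Tendsto (fun ε => ‖m.comp W.mkQL‖ * (‖x‖ + ε)) (𝓝[>] 0)
        (𝓝 (‖m.comp W.mkQL‖ * ‖x‖)) :=
      (Continuous.tendsto' (by fun_prop) 0 _ (by simp)).mono_left nhdsWithin_le_nhds
    exact ge_of_tendsto tendsto_bound (eventually_mem_nhdsWithin.mono bound_lift)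

section NormGaussian

variable {E : Type*} [NormedAddCommGroup E]

lemma normGaussian_eq_of_isAddHaarMeasure [NormedSpace ℝ E] [FiniteDimensional ℝ E]
    [MeasurableSpace E] [BorelSpace E] (μ : Measure E) [μ.IsAddHaarMeasure] :
    normGaussian E = (∫⁻ x, ENNReal.ofReal (Real.exp (-‖x‖ ^ 2)) ∂μ)⁻¹ •
      μ.withDensity fun x => ENNReal.ofReal (Real.exp (-‖x‖ ^ 2)) := by
  let c : ENNReal := Measure.addHaarScalarFactor (Measure.addHaar : Measure E) μ
  have c_ne_zero : c ≠ 0 := by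
    simpa [c] using (Measure.addHaarScalarFactor_pos_of_isAddHaarMeasure _ μ).ne'
  have c_ne_top : c ≠ ⊤ := ENNReal.coe_ne_top
  have haar_eq : (Measure.addHaar : Measure E) = c • μ :=
    Measure.isAddLeftInvariant_eq_smul _ _
  rw [normGaussian, haar_eq, lintegral_smul_measure, withDensity_smul_measure, smul_smul,
    smul_eq_mul, ENNReal.mul_inv (.inl c_ne_zero) (.inl c_ne_top), mul_right_comm,
    ENNReal.inv_mul_cancel c_ne_zero c_ne_top, one_mul]

variable [InnerProductSpace ℝ E] [FiniteDimensional ℝ E] [MeasurableSpace E] [BorelSpace E]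

lemma integral_exp_neg_sq_norm_mul_exp_inner (t : E) :
    ∫ x : E, Real.exp (-‖x‖ ^ 2) • Complex.exp (inner ℝ x t * Complex.I) =
      (Real.pi : ℂ) ^ (Module.finrank ℝ E / 2 : ℂ) * Complex.exp (-(‖t‖ ^ 2 / 4 : ℝ)) := by
  have gaussian := GaussianFourier.integral_cexp_neg_mul_sq_norm_add (b := 1) (by simp) Complex.I t
  simp only [neg_mul, one_mul, div_one, mul_one, Complex.I_sq] at gaussian
  convert gaussian using 1
  · congr 1 with x
    rw [Complex.real_smul, Complex.ofReal_exp, ← Complex.exp_add, real_inner_comm]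
    push_cast
    ring_nf
  · push_cast
    ring_nf

theorem charFun_normGaussian (t : E) :
    charFun (normGaussian E) t = Complex.exp (-(‖t‖ ^ 2 / 4 : ℝ)) := by
  have mass : ((∫⁻ x : E, ENNReal.ofReal (Real.exp (-‖x‖ ^ 2))).toReal : ℂ) =
      (Real.pi : ℂ) ^ (Module.finrank ℝ E / 2 : ℂ) := by
    rw [← integral_eq_lintegral_of_nonneg_ae (.of_forall fun x => by positivity) (by fun_prop),
      ← integral_complex_ofReal]
    simpa using integral_exp_neg_sq_norm_mul_exp_inner (0 : E)
  have mass_ne_zero : (Real.pi : ℂ) ^ (Module.finrank ℝ E / 2 : ℂ) ≠ 0 := by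
    simp [Complex.cpow_eq_zero_iff, Real.pi_ne_zero]
  rw [charFun_apply, normGaussian_eq_of_isAddHaarMeasure volume, integral_smul_measure,
    integral_withDensity_eq_integral_toReal_smul (by fun_prop) (.of_forall fun _ => by simp)]
  simp_rw [ENNReal.toReal_ofReal (Real.exp_nonneg _)]
  rw [integral_exp_neg_sq_norm_mul_exp_inner, Complex.real_smul, ENNReal.toReal_inv,
    Complex.ofReal_inv, mass, inv_mul_cancel_left₀ mass_ne_zero]

lemma charFunDual_normGaussian (m : StrongDual ℝ E) :
    charFunDual (normGaussian E) m = Complex.exp (-(‖m‖ ^ 2 / 4 : ℝ)) := by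
  rw [← charFun_toDual_symm_eq_charFunDual, charFun_normGaussian, LinearIsometryEquiv.norm_map]

instance isProbabilityMeasure_normGaussian : IsProbabilityMeasure (normGaussian E) := by
  have charFun_zero_eq_one : charFun (normGaussian E) 0 = 1 :=
    (charFun_normGaussian 0).trans (by simp)
  rw [isProbabilityMeasure_iff_real]
  rw [charFun_zero] at charFun_zero_eq_one
  exact_mod_cast charFun_zero_eq_one

end NormGaussian

section GaussianLimit

variable {Q : Type*} [NormedAddCommGroup Q] [InnerProductSpace ℝ Q] [CompleteSpace Q]
  {ν : Measure (HatSpace Q)}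

open HatSpace

theorem isGaussianLimit_iff_charFunctional_eq :
    IsGaussianLimit ν ↔ ∀ l, charFunctional ν l = Complex.exp (-(‖l‖ ^ 2 / 4 : ℝ)) := by
  refine ⟨fun hν l => ?_, fun h W hW _ => ?_⟩
  · let W := LinearMap.ker l.toLinearMap
    have hW : IsClosed (W : Set Q) := l.isClosed_ker
    have : FiniteDimensional ℝ (Q ⧸ W) := Module.Finite.equiv l.quotKerEquivRange.symm
    have : CompleteSpace W := hW.completeSpace_coe
    let : MeasurableSpace (Q ⧸ W) := borel (Q ⧸ W)
    have : BorelSpace (Q ⧸ W) := ⟨rfl⟩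
    let m : StrongDual ℝ (Q ⧸ W) := LinearMap.toContinuousLinearMap (W.liftQ l.toLinearMap le_rfl)
    have comp_mkQL : m.comp W.mkQL = l := rfl
    rw [← comp_mkQL, ← charFunDual_map_proj, hν W, charFunDual_normGaussian, norm_comp_mkQL]
  · have : CompleteSpace W := hW.completeSpace_coe
    have : ProperSpace (Q ⧸ W) := FiniteDimensional.proper_real _
    let : MeasurableSpace (Q ⧸ W) := borel (Q ⧸ W)
    have : BorelSpace (Q ⧸ W) := ⟨rfl⟩
    have : IsProbabilityMeasure ν := charFunctional_zero_eq_one_iff.1 (by simp [h])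
    have := Measure.isProbabilityMeasure_map (μ := ν) (measurable_proj W).aemeasurable
    refine Measure.ext_of_charFunDual (funext fun m => ?_)
    rw [charFunDual_map_proj, h, charFunDual_normGaussian, norm_comp_mkQL]

namespace IsGaussianLimit

lemma isProbabilityMeasure (hν : IsGaussianLimit ν) : IsProbabilityMeasure ν :=
  charFunctional_zero_eq_one_iff.1 (by simp [isGaussianLimit_iff_charFunctional_eq.1 hν])

theorem map_ev (hν : IsGaussianLimit ν) (l : Q →L[ℝ] ℝ) :
    ν.map (ev l) = ProbabilityTheory.gaussianReal 0 (‖l‖₊ ^ 2 / 2) := by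
  have := hν.isProbabilityMeasure
  have := Measure.isProbabilityMeasure_map (μ := ν) (measurable_ev l).aemeasurable
  refine Measure.ext_of_charFun (funext fun t => ?_)
  rw [charFun_map_ev, isGaussianLimit_iff_charFunctional_eq.1 hν,
    ProbabilityTheory.charFun_gaussianReal, norm_smul]
  simp only [mul_pow, Real.norm_eq_abs, sq_abs, Complex.ofReal_zero, mul_zero, zero_mul, zero_sub,
    NNReal.coe_div, NNReal.coe_pow, coe_nnnorm, NNReal.coe_ofNat]
  push_cast
  ring_nf

protected theorem unique {μ : Measure (HatSpace Q)} (hμ : IsGaussianLimit μ)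
    (hν : IsGaussianLimit ν) : μ = ν := by
  have := hμ.isProbabilityMeasure
  have := hν.isProbabilityMeasure
  refine ext_of_charFunctional fun l => ?_
  rw [isGaussianLimit_iff_charFunctional_eq.1 hμ, isGaussianLimit_iff_charFunctional_eq.1 hν]

end IsGaussianLimit

end GaussianLimit

section IsonormalProcess

open ProbabilityTheory

lemma orthonormal_toLp_of_covariance_eq_zero {Ω ι : Type*} {mΩ : MeasurableSpace Ω}
    {P : Measure Ω} {X : ι → Ω → ℝ} (hX : ∀ i, MemLp (X i) 2 P) (mean_zero : ∀ i, P[X i] = 0)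
    (var_one : ∀ i, Var[X i; P] = 1) (cov_zero : Pairwise fun i j => cov[X i, X j; P] = 0) :
    Orthonormal ℝ fun i => (hX i).toLp := by
  classical
  have inner_eq_cov : ∀ i j, inner ℝ (hX i).toLp (hX j).toLp = cov[X i, X j; P] := by
    intro i j
    simp_rw [covariance, mean_zero, sub_zero, L2.inner_def]
    refine integral_congr_ae ?_
    filter_upwards [(hX i).coeFn_toLp, (hX j).coeFn_toLp] with ω hi hj
    simp [hi, hj, mul_comm]
  refine orthonormal_iff_ite.2 fun i j => ?_
  split_ifs with hij
  · rw [inner_eq_cov, hij, covariance_self (hX j).aemeasurable, var_one]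
  · rw [inner_eq_cov, cov_zero hij]

/-- The law of a family of independent standard Gaussian random variables indexed by `ι`, given by
the coordinates of `ι → ℝ`. -/
noncomputable def iidGaussian (ι : Type*) : Measure (ι → ℝ) :=
  Measure.infinitePi fun _ => gaussianReal 0 1

variable {ι : Type*}

instance : IsProbabilityMeasure (iidGaussian ι) :=
  inferInstanceAs (IsProbabilityMeasure (Measure.infinitePi _))

lemma hasLaw_eval_iidGaussian (i : ι) :
    HasLaw (fun ω : ι → ℝ => ω i) (gaussianReal 0 1) (iidGaussian ι) :=
  (measurePreserving_eval_infinitePi (fun _ => gaussianReal 0 1) i).hasLaw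

lemma memLp_eval_iidGaussian (i : ι) : MemLp (fun ω : ι → ℝ => ω i) 2 (iidGaussian ι) :=
  (memLp_id_gaussianReal 2).comp_measurePreserving (measurePreserving_eval_infinitePi _ i)

lemma iIndepFun_eval_iidGaussian : iIndepFun (fun i (ω : ι → ℝ) => ω i) (iidGaussian ι) :=
  iIndepFun_infinitePi (X := fun _ x => x) fun _ => measurable_id

lemma orthonormal_eval_iidGaussian :
    Orthonormal ℝ fun i : ι => (memLp_eval_iidGaussian i).toLp := by
  refine orthonormal_toLp_of_covariance_eq_zero _ (fun i => ?_) (fun i => ?_) fun i j hij => ?_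
  · simpa using (hasLaw_eval_iidGaussian i).integral_eq
  · simpa using (hasLaw_eval_iidGaussian i).variance_eq
  · exact (iIndepFun_eval_iidGaussian.indepFun hij).covariance_eq_zero
      (memLp_eval_iidGaussian i) (memLp_eval_iidGaussian j)

lemma integral_exp_sum_mul_I_iidGaussian (s : Finset ι) (c : ι → ℝ) :
    ∫ ω : ι → ℝ, Complex.exp ((∑ i ∈ s, c i * ω i : ℝ) * Complex.I) ∂iidGaussian ι =
      Complex.exp (-((∑ i ∈ s, c i ^ 2) / 2 : ℝ)) := by
  have indep : iIndepFun (fun i (ω : ι → ℝ) => c i * ω i) (iidGaussian ι) :=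
    iIndepFun_eval_iidGaussian.comp (fun i x => c i * x) fun i => measurable_const_mul (c i)
  have charFun_sum := congr_fun (iIndepFun.charFun_map_fun_finsetSum_eq_prod (s := s)
    (fun i _ => Measurable.aemeasurable (by fun_prop)) (indep.restrict s)) 1
  rw [charFun_apply_real, integral_map (Measurable.aemeasurable (by fun_prop)) (by fun_prop),
    Finset.prod_apply]
    at charFun_sum
  simp_rw [(gaussianReal_const_mul (hasLaw_eval_iidGaussian _) (c _)).map_eq,
    charFun_gaussianReal, ← Complex.exp_sum] at charFun_sum
  simpa [← Finset.sum_neg_distrib, Finset.sum_div, neg_div] using charFun_sum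

lemma norm_exp_mul_I_sub_exp_mul_I_le (x y : ℝ) :
    ‖Complex.exp (x * Complex.I) - Complex.exp (y * Complex.I)‖ ≤ |x - y| := by
  have factor : Complex.exp (x * Complex.I) - Complex.exp (y * Complex.I) =
      Complex.exp (y * Complex.I) * (Complex.exp (Complex.I * (x - y : ℝ)) - 1) := by
    rw [mul_sub_one, ← Complex.exp_add]
    push_cast
    ring_nf
  rw [factor, norm_mul, Complex.norm_exp_ofReal_mul_I, one_mul]
  exact Real.norm_exp_I_mul_ofReal_sub_one_le

lemma lipschitzWith_integral_exp_mul_I {Ω : Type*} [MeasurableSpace Ω] (P : Measure Ω)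
    [IsProbabilityMeasure P] (p : ENNReal) [Fact (1 ≤ p)] :
    LipschitzWith 1 fun f : Lp ℝ p P => ∫ ω, Complex.exp (f ω * Complex.I) ∂P := by
  have integrable_exp : ∀ f : Lp ℝ p P, Integrable (fun ω => Complex.exp (f ω * Complex.I)) P := by
    intro f
    have := (Lp.aestronglyMeasurable f).aemeasurable
    exact .of_bound (AEMeasurable.aestronglyMeasurable (by fun_prop)) 1
      (.of_forall fun ω => (Complex.norm_exp_ofReal_mul_I _).le)
  refine LipschitzWith.of_dist_le_mul fun f g => ?_
  have memLp_sub : MemLp (f - g : Lp ℝ p P) p P := Lp.memLp (f - g)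
  have integrable_sub : Integrable (f - g : Lp ℝ p P) P := memLp_sub.integrable Fact.out
  rw [dist_eq_norm, dist_eq_norm, ← integral_sub (integrable_exp f) (integrable_exp g),
    NNReal.coe_one, one_mul]
  calc ‖∫ ω, (Complex.exp (f ω * Complex.I) - Complex.exp (g ω * Complex.I)) ∂P‖
      ≤ ∫ ω, ‖(f - g : Lp ℝ p P) ω‖ ∂P := by
        refine norm_integral_le_of_norm_le integrable_sub.norm ?_
        filter_upwards [Lp.coeFn_sub f g] with ω hω
        rw [hω]
        exact norm_exp_mul_I_sub_exp_mul_I_le _ _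
    _ = (eLpNorm (f - g : Lp ℝ p P) 1 P).toReal := by
        rw [eLpNorm_one_eq_lintegral_enorm, integral_norm_eq_lintegral_enorm memLp_sub.1]
    _ ≤ (eLpNorm (f - g : Lp ℝ p P) p P).toReal :=
        ENNReal.toReal_mono memLp_sub.2.ne
          (eLpNorm_le_eLpNorm_of_exponent_le Fact.out memLp_sub.1)
    _ = ‖f - g‖ := (Lp.norm_def _).symm

section GaussianIsometry

variable {H : Type*} [NormedAddCommGroup H] [InnerProductSpace ℝ H] (b : HilbertBasis ι ℝ H)

/-- The isonormal Gaussian process over the Hilbert space `H`, as the isometric embedding of `H`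
into `L²` that sends a Hilbert basis to independent standard Gaussian variables. -/
noncomputable def gaussianIsometry : H →ₗᵢ[ℝ] Lp ℝ 2 (iidGaussian ι) :=
  orthonormal_eval_iidGaussian.orthogonalFamily.linearIsometry.comp b.repr.toLinearIsometry

lemma gaussianIsometry_apply_basis (i : ι) :
    gaussianIsometry b (b i) = (memLp_eval_iidGaussian i).toLp := by
  classical
  rw [gaussianIsometry, LinearIsometry.coe_comp, Function.comp_apply,
    LinearIsometryEquiv.coe_toLinearIsometry, b.repr_self,
    OrthogonalFamily.linearIsometry_apply_single, LinearIsometry.toSpanSingleton_apply, one_smul]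

lemma coeFn_gaussianIsometry_sum (s : Finset ι) (c : ι → ℝ) :
    gaussianIsometry b (∑ i ∈ s, c i • b i) =ᵐ[iidGaussian ι] fun ω => ∑ i ∈ s, c i * ω i := by
  have coeFn_smul_basis : ∀ i ∈ s, (c i • gaussianIsometry b (b i) : Lp ℝ 2 (iidGaussian ι))
      =ᵐ[iidGaussian ι] fun ω => c i * ω i := fun i _ => by
    rw [gaussianIsometry_apply_basis]
    filter_upwards [Lp.coeFn_smul (c i) (memLp_eval_iidGaussian i).toLp,
      (memLp_eval_iidGaussian i).coeFn_toLp] with ω h_smul h_toLp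
    rw [h_smul, Pi.smul_apply, h_toLp, smul_eq_mul]
  simp_rw [map_sum, map_smul]
  filter_upwards [Lp.coeFn_finsetSum s fun i => c i • gaussianIsometry b (b i),
    (eventually_all_finset s).2 coeFn_smul_basis] with ω h_sum h_smul
  rw [h_sum, Finset.sum_apply]
  exact Finset.sum_congr rfl h_smul

theorem integral_exp_gaussianIsometry_mul_I (x : H) :
    ∫ ω, Complex.exp (gaussianIsometry b x ω * Complex.I) ∂iidGaussian ι =
      Complex.exp (-(‖x‖ ^ 2 / 2 : ℝ)) := by
  have eq_on_sums : ∀ s : Finset ι,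
      ∫ ω, Complex.exp (gaussianIsometry b (∑ i ∈ s, b.repr x i • b i) ω * Complex.I)
        ∂iidGaussian ι = Complex.exp (-(‖∑ i ∈ s, b.repr x i • b i‖ ^ 2 / 2 : ℝ)) := fun s => by
    have norm_sq_sum : ‖∑ i ∈ s, b.repr x i • b i‖ ^ 2 = ∑ i ∈ s, b.repr x i ^ 2 := by
      rw [← real_inner_self_eq_norm_sq, b.orthonormal.inner_sum]
      simp [pow_two]
    rw [norm_sq_sum, ← integral_exp_sum_mul_I_iidGaussian]
    refine integral_congr_ae ?_
    filter_upwards [coeFn_gaussianIsometry_sum b s (b.repr x)] with ω hω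
    rw [hω]
  have continuous_lhs := (lipschitzWith_integral_exp_mul_I (iidGaussian ι) 2).continuous.comp
    (gaussianIsometry b).continuous
  have continuous_rhs : Continuous fun x : H => Complex.exp (-(‖x‖ ^ 2 / 2 : ℝ)) := by fun_prop
  exact tendsto_nhds_unique_of_eventuallyEq ((continuous_lhs.tendsto x).comp (b.hasSum_repr x))
    ((continuous_rhs.tendsto x).comp (b.hasSum_repr x)) (.of_forall eq_on_sums)

end GaussianIsometry

end IsonormalProcess

section Existence

variable {Q : Type*} [NormedAddCommGroup Q]

theorem HatSpace.exists_measurable_ev_ae_eq [NormedSpace ℝ Q] {Ω : Type*} [MeasurableSpace Ω]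
    {P : Measure Ω} (R : (Q →L[ℝ] ℝ) →ₗ[ℝ] Ω →ₘ[P] ℝ) :
    ∃ Ψ : Ω → HatSpace Q, Measurable Ψ ∧ ∀ l, (fun ω => ev l (Ψ ω)) =ᵐ[P] R l := by
  let B := Module.Basis.ofVectorSpace ℝ (Q →L[ℝ] ℝ)
  let Ψ : Ω → HatSpace Q := fun ω => B.constr ℝ fun j => R (B j) ω
  have ev_basis : ∀ j, (fun ω => ev (B j) (Ψ ω)) = R (B j) :=
    fun j => funext fun ω => B.constr_basis ℝ _ j
  have measurable_Ψ : Measurable Ψ := measurable_of_measurable_ev fun l => by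
    have ev_eq_sum : ∀ ω, ev l (Ψ ω) = (B.repr l).sum fun j a => a • R (B j) ω :=
      fun ω => B.constr_apply ℝ _ l
    simp_rw [ev_eq_sum]
    exact Finset.measurable_sum _ fun j _ => (R (B j)).measurable.const_smul (B.repr l j)
  let Ψlin : (Q →L[ℝ] ℝ) →ₗ[ℝ] Ω →ₘ[P] ℝ :=
    { toFun := fun l => AEEqFun.mk (fun ω => ev l (Ψ ω))
        ((measurable_ev l).comp measurable_Ψ).aestronglyMeasurable
      map_add' := fun l l' => by simp_rw [ev_add]; rfl
      map_smul' := fun r l => by simp_rw [ev_smul]; rfl }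
  have Ψlin_eq : Ψlin = R := B.ext fun j => by
    refine AEEqFun.ext ((AEEqFun.coeFn_mk _ _).trans ?_)
    rw [ev_basis]
  refine ⟨Ψ, measurable_Ψ, fun l => ?_⟩
  rw [← Ψlin_eq]
  exact (AEEqFun.coeFn_mk _ _).symm

variable [InnerProductSpace ℝ Q] [CompleteSpace Q]

theorem exists_isGaussianLimit : ∃ ν : Measure (HatSpace Q), IsGaussianLimit ν := by
  obtain ⟨ι, b, -⟩ := exists_hilbertBasis ℝ Q
  let T : (Q →L[ℝ] ℝ) →ₗ[ℝ] Lp ℝ 2 (iidGaussian ι) :=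
    (√2)⁻¹ • (gaussianIsometry b).toLinearMap ∘ₗ
      (InnerProductSpace.toDual ℝ Q).symm.toLinearEquiv.toLinearMap
  have integral_exp_T : ∀ l, ∫ ω, Complex.exp (T l ω * Complex.I) ∂iidGaussian ι =
      Complex.exp (-(‖l‖ ^ 2 / 4 : ℝ)) := fun l => by
    have T_apply : T l = gaussianIsometry b ((√2)⁻¹ • (InnerProductSpace.toDual ℝ Q).symm l) := by
      rw [map_smul]
      rfl
    rw [T_apply, integral_exp_gaussianIsometry_mul_I, norm_smul, LinearIsometryEquiv.norm_map,
      mul_pow, norm_inv, Real.norm_of_nonneg (Real.sqrt_nonneg 2), inv_pow,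
      Real.sq_sqrt zero_le_two]
    ring_nf
  obtain ⟨Ψ, measurable_Ψ, ev_Ψ⟩ := HatSpace.exists_measurable_ev_ae_eq
    ((Lp.LpSubmodule ℝ ℝ 2 (iidGaussian ι)).subtype ∘ₗ T)
  refine ⟨(iidGaussian ι).map Ψ, isGaussianLimit_iff_charFunctional_eq.2 fun l => ?_⟩
  rw [HatSpace.charFunctional, integral_map measurable_Ψ.aemeasurable
    (HatSpace.measurable_character l).aestronglyMeasurable, ← integral_exp_T]
  refine integral_congr_ae ?_
  filter_upwards [ev_Ψ l] with ω hω
  rw [HatSpace.character, hω]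
  rfl

theorem existsUnique_isGaussianLimit : ∃! ν : Measure (HatSpace Q), IsGaussianLimit ν :=
  exists_isGaussianLimit.imp fun _ hν => ⟨hν, fun _ hμ => hμ.unique hν⟩

end Existence

namespace HatSpace

variable {Q : Type*} [NormedAddCommGroup Q] [NormedSpace ℝ Q] {ν : Measure (HatSpace Q)}

lemma memLp_character [IsFiniteMeasure ν] (p : ENNReal) (l : Q →L[ℝ] ℝ) :
    MemLp (character l) p ν :=
  .of_bound (measurable_character l).aestronglyMeasurable 1
    (.of_forall fun Φ => (norm_character l Φ).le)

lemma integrable_smul_character {𝕜 : Type*} [RCLike 𝕜] [NormedSpace 𝕜 ℂ] {f : HatSpace Q → 𝕜}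
    (hf : Integrable f ν) (l : Q →L[ℝ] ℝ) : Integrable (fun Φ => f Φ • character l Φ) ν :=
  hf.smul_bdd 1 (measurable_character l).aestronglyMeasurable
    (.of_forall fun Φ => (norm_character l Φ).le)

lemma charFunctional_withDensity_ofReal {g : HatSpace Q → ℝ} (hg : AEMeasurable g ν)
    (l : Q →L[ℝ] ℝ) :
    charFunctional (ν.withDensity fun Φ => ENNReal.ofReal (g Φ)) l =
      ∫ Φ, max (g Φ) 0 • character l Φ ∂ν := by
  rw [charFunctional, integral_withDensity_eq_integral_toReal_smul₀ hg.ennreal_ofReal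
    (.of_forall fun _ => ENNReal.ofReal_lt_top)]
  simp_rw [ENNReal.toReal_ofReal']

theorem ae_eq_zero_of_forall_integral_smul_character_real {g : HatSpace Q → ℝ}
    (hg : Integrable g ν) (h : ∀ l, ∫ Φ, g Φ • character l Φ ∂ν = 0) : g =ᵐ[ν] 0 := by
  have := isFiniteMeasure_withDensity_ofReal hg.2
  have := isFiniteMeasure_withDensity_ofReal hg.neg.2
  have density_eq : (ν.withDensity fun Φ => ENNReal.ofReal (g Φ)) =
      ν.withDensity fun Φ => ENNReal.ofReal ((-g) Φ) := by
    refine ext_of_charFunctional fun l => ?_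
    rw [charFunctional_withDensity_ofReal hg.aemeasurable,
      charFunctional_withDensity_ofReal hg.neg.aemeasurable, ← sub_eq_zero,
      ← integral_sub (integrable_smul_character hg.pos_part l)
        (integrable_smul_character hg.neg.pos_part l), ← h l]
    simp_rw [← sub_smul, Pi.neg_apply, max_zero_sub_eq_self]
  rw [withDensity_eq_iff hg.aemeasurable.ennreal_ofReal hg.neg.aemeasurable.ennreal_ofReal
    hg.lintegral_lt_top.ne] at density_eq
  filter_upwards [density_eq] with Φ hΦ
  have max_eq : max (g Φ) 0 = max (-g Φ) 0 := by
    simpa only [ENNReal.toReal_ofReal', Pi.neg_apply] using congrArg ENNReal.toReal hΦ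
  rw [← max_zero_sub_eq_self (g Φ), max_eq, sub_self, Pi.zero_apply]

lemma integral_re_smul_character {f : HatSpace Q → ℂ} (hf : Integrable f ν) (l : Q →L[ℝ] ℝ) :
    ∫ Φ, (f Φ).re • character l Φ ∂ν =
      (∫ Φ, f Φ • character l Φ ∂ν + starRingEnd ℂ (∫ Φ, f Φ • character (-l) Φ ∂ν)) / 2 := by
  have integrable_conj :
      Integrable (fun Φ => starRingEnd ℂ (f Φ • character (-l) Φ)) ν :=
    Complex.conjLIE.integrable_comp_iff.2 (integrable_smul_character hf (-l))
  rw [← integral_conj, ← integral_add (integrable_smul_character hf l) integrable_conj,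
    ← integral_div]
  congr 1 with Φ
  rw [character_neg, smul_eq_mul, smul_eq_mul, map_mul, Complex.conj_conj, Complex.real_smul,
    Complex.re_eq_add_conj]
  ring

theorem ae_eq_zero_of_forall_integral_smul_character {f : HatSpace Q → ℂ} (hf : Integrable f ν)
    (h : ∀ l, ∫ Φ, f Φ • character l Φ ∂ν = 0) : f =ᵐ[ν] 0 := by
  have re_eq_zero : ∀ {g : HatSpace Q → ℂ}, Integrable g ν →
      (∀ l, ∫ Φ, g Φ • character l Φ ∂ν = 0) → (fun Φ => (g Φ).re) =ᵐ[ν] 0 := fun hg hg_zero =>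
    ae_eq_zero_of_forall_integral_smul_character_real hg.re fun l => by
      rw [integral_re_smul_character hg, hg_zero, hg_zero, map_zero, add_zero, zero_div]
  have neg_I_smul_zero : ∀ l, ∫ Φ, (-Complex.I • f) Φ • character l Φ ∂ν = 0 := fun l => by
    simp_rw [Pi.smul_apply, smul_assoc, integral_smul, h, smul_zero]
  filter_upwards [re_eq_zero hf h, re_eq_zero (hf.smul (-Complex.I)) neg_I_smul_zero]
    with Φ h_re h_im
  exact Complex.ext h_re (by simpa using h_im)

theorem dense_span_character [IsFiniteMeasure ν] :
    Dense (Submodule.span ℂ (Set.range fun l : Q →L[ℝ] ℝ =>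
      (memLp_character (ν := ν) 2 l).toLp) : Set (Lp ℂ 2 ν)) := by
  rw [Submodule.dense_iff_topologicalClosure_eq_top, Submodule.topologicalClosure_eq_top_iff,
    Submodule.eq_bot_iff]
  intro f hf
  rw [Lp.eq_zero_iff_ae_eq_zero]
  refine ae_eq_zero_of_forall_integral_smul_character
    ((Lp.memLp f).integrable one_le_two) fun l => ?_
  rw [← (Submodule.mem_orthogonal _ _).1 hf _ (Submodule.subset_span ⟨-l, rfl⟩), L2.inner_def]
  refine integral_congr_ae ?_
  filter_upwards [(memLp_character (ν := ν) 2 (-l)).coeFn_toLp] with Φ hΦ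
  rw [hΦ, RCLike.inner_apply, character_neg, Complex.conj_conj, smul_eq_mul]

end HatSpace

open HatSpace in
theorem IsGaussianLimit.memLp_exp {Q : Type*} [NormedAddCommGroup Q] [InnerProductSpace ℝ Q]
    [CompleteSpace Q] {ν : Measure (HatSpace Q)} (hν : IsGaussianLimit ν) (a b : Q →L[ℝ] ℝ)
    (c : ℂ) {p : ENNReal} (hp : p ≠ ⊤) :
    MemLp (fun Φ => Complex.exp (ev a Φ + Complex.I * ev b Φ + c)) p ν := by
  rcases eq_or_ne p 0 with rfl | hp_zero
  · exact memLp_zero_iff_aestronglyMeasurable.2 (by fun_prop)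
  rw [← integrable_norm_rpow_iff (by fun_prop) hp_zero hp]
  have integrable_exp : Integrable (fun Φ => Real.exp (p.toReal * ev a Φ)) ν := by
    have := ProbabilityTheory.integrable_exp_mul_gaussianReal
      (μ := 0) (v := ‖a‖₊ ^ 2 / 2) p.toReal
    rw [← hν.map_ev] at this
    exact this.comp_measurable (measurable_ev a)
  refine (integrable_exp.const_mul (Real.exp (p.toReal * c.re))).congr (.of_forall fun Φ => ?_)
  have norm_eq : ‖Complex.exp (ev a Φ + Complex.I * ev b Φ + c)‖ = Real.exp (ev a Φ + c.re) := by
    simp [Complex.norm_exp]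
  simp only [norm_eq, ← Real.exp_mul, ← Real.exp_add]
  ring_nf

namespace LinearFieldTheory.VacuumForm

variable {L : Type*} [AddCommGroup L] [Module ℝ L] {S : LinearFieldTheory L} (V : S.VacuumForm)

/-- The extension of the coherent state `k_τ` to `Q̂`, with the continuous functional `b` standing
for `Im Ω(q τ,·) + [τ,·]`; for admissible `Ω`, `redCoherentHat hV τ` is the case `b = imL hV τ`. -/
noncomputable def coherentExtension (τ : L) (b : V.Q →L[ℝ] ℝ) (Φ : HatSpace V.Q) : ℂ :=
  Complex.exp ((HatSpace.ev (V.reL τ) Φ : ℂ) + Complex.I * (HatSpace.ev b Φ : ℂ)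
    - (1 / 2 : ℂ) * V.form (V.q τ) (V.q τ) - Complex.I / 2 * (S.pot τ τ : ℂ))

variable {V} {τ : L} {b : V.Q →L[ℝ] ℝ}

lemma form_add_I_mul_bracket_eq (hb : ∀ φ, b φ = (V.form (V.q τ) φ).im + V.bracket τ φ)
    (φ : V.Q) : V.form (V.q τ) φ + Complex.I * V.bracket τ φ = V.reL τ φ + Complex.I * b φ := by
  have reL_apply : V.reL τ φ = (V.form (V.q τ) φ).re := rfl
  apply Complex.ext <;> simp [reL_apply, hb]

theorem isCylindricalExtension_coherentExtension
    (hb : ∀ φ, b φ = (V.form (V.q τ) φ).im + V.bracket τ φ) :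
    IsCylindricalExtension (V.redCoherent τ) (V.coherentExtension τ b) := by
  unfold redCoherent
  simp_rw [form_add_I_mul_bracket_eq hb]
  exact HatSpace.isCylindricalExtension_comp_ev ![V.reL τ, b] fun x =>
    Complex.exp (x 0 + Complex.I * x 1 - 1 / 2 * V.form (V.q τ) (V.q τ) -
      Complex.I / 2 * S.pot τ τ)

lemma exists_mem_M_bracket_eq (ξ : L) : ∃ τ ∈ S.M, V.bracket τ = V.bracket ξ := by
  obtain ⟨τ, hτ, η, hη, rfl⟩ := Submodule.mem_sup.1 (S.generate ▸ Submodule.mem_top : ξ ∈ _)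
  refine ⟨τ, hτ, LinearMap.ext fun φ => ?_⟩
  obtain ⟨χ, rfl⟩ := Submodule.mkQ_surjective S.M φ
  change S.pot τ χ = S.pot (τ + η) χ
  rw [map_add, LinearMap.mem_ker.1 hη, add_zero]

lemma q_eq_zero_of_mem_M (hτ : τ ∈ S.M) : V.q τ = 0 :=
  (Submodule.Quotient.mk_eq_zero _).2 hτ

lemma coherentExtension_of_mem_M (hτ : τ ∈ S.M) :
    V.coherentExtension τ b = HatSpace.character b := by
  have reL_eq_zero : V.reL τ = 0 := by rw [reL, q_eq_zero_of_mem_M hτ, map_zero]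
  have pot_self : S.pot τ τ = 0 := LinearMap.congr_fun (LinearMap.mem_ker.1 hτ) τ
  ext1 Φ
  rw [coherentExtension, HatSpace.character, reL_eq_zero, HatSpace.ev_zero, pot_self,
    q_eq_zero_of_mem_M hτ]
  simp [mul_comm]

theorem memLp_coherentExtension [CompleteSpace V.Q] {ν : Measure (HatSpace V.Q)}
    (hν : IsGaussianLimit ν) (τ : L) (b : V.Q →L[ℝ] ℝ) {p : ENNReal} (hp : p ≠ ⊤) :
    MemLp (V.coherentExtension τ b) p ν := by
  have := hν.memLp_exp (V.reL τ) b
    (-((1 / 2 : ℂ) * V.form (V.q τ) (V.q τ)) - Complex.I / 2 * S.pot τ τ) hp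
  unfold coherentExtension
  simpa only [← add_sub_assoc, ← sub_eq_add_neg] using this

theorem dense_span_coherentExtension {ν : Measure (HatSpace V.Q)} [IsFiniteMeasure ν]
    {b : L → V.Q →L[ℝ] ℝ} (hb : ∀ τ φ, b τ φ = (V.form (V.q τ) φ).im + V.bracket τ φ)
    (bracket_surjective : ∀ l : V.Q →L[ℝ] ℝ, ∃ ξ : L, ∀ φ, l φ = V.bracket ξ φ)
    (hk : ∀ τ, MemLp (V.coherentExtension τ (b τ)) 2 ν) :
    Dense (Submodule.span ℂ (Set.range fun τ : L => (hk τ).toLp) : Set (Lp ℂ 2 ν)) := by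
  refine HatSpace.dense_span_character.mono (Submodule.span_mono ?_)
  rintro _ ⟨l, rfl⟩
  obtain ⟨ξ, hξ⟩ := bracket_surjective l
  obtain ⟨τ, hτ, bracket_eq⟩ := V.exists_mem_M_bracket_eq ξ
  have b_eq : b τ = l := ContinuousLinearMap.ext fun φ => by
    rw [hb, q_eq_zero_of_mem_M hτ, map_zero, LinearMap.zero_apply, Complex.zero_im, zero_add,
      bracket_eq, hξ]
  refine ⟨τ, MemLp.toLp_congr _ _ (.of_forall fun Φ => ?_)⟩
  rw [coherentExtension_of_mem_M hτ, b_eq]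

end LinearFieldTheory.VacuumForm

theorem mainTheorem5_general {L : Type*} [AddCommGroup L] [Module ℝ L] (S : LinearFieldTheory L)
    (V : S.VacuumForm) [CompleteSpace V.Q] (b : L → V.Q →L[ℝ] ℝ)
    (hb : ∀ τ φ, b τ φ = (V.form (V.q τ) φ).im + V.bracket τ φ)
    (bracket_surjective : ∀ l : V.Q →L[ℝ] ℝ, ∃ ξ : L, ∀ φ, l φ = V.bracket ξ φ) :
    (∃! ν : Measure (HatSpace V.Q), IsGaussianLimit ν) ∧
    (∀ τ : L, IsCylindricalExtension (V.redCoherent τ) (V.coherentExtension τ (b τ))) ∧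
    ∀ ν : Measure (HatSpace V.Q), IsGaussianLimit ν →
      ∃ hk : ∀ τ : L, MemLp (V.coherentExtension τ (b τ)) 2 ν,
        Dense (Submodule.span ℂ (Set.range fun τ : L => (hk τ).toLp) : Set (Lp ℂ 2 ν)) := by
  refine ⟨existsUnique_isGaussianLimit, fun τ => V.isCylindricalExtension_coherentExtension (hb τ),
    fun ν hν => ?_⟩
  have := hν.isProbabilityMeasure
  exact ⟨fun τ => V.memLp_coherentExtension hν τ (b τ) ENNReal.ofNat_ne_top,
    V.dense_span_coherentExtension hb bracket_surjective _⟩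

theorem mainTheorem5 {L : Type*} [AddCommGroup L] [Module ℝ L] (S : LinearFieldTheory L)
    (V : S.VacuumForm) (hV : V.Admissible) :
    (∃! ν : MeasureTheory.Measure (HatSpace V.Q), IsGaussianLimit ν) ∧
    (∀ τ : L, IsCylindricalExtension (V.redCoherent τ)
      (LinearFieldTheory.VacuumForm.redCoherentHat hV τ)) ∧
    ∀ ν : MeasureTheory.Measure (HatSpace V.Q), IsGaussianLimit ν →
      ∃ hk : ∀ τ : L,
          MeasureTheory.MemLp (LinearFieldTheory.VacuumForm.redCoherentHat hV τ) 2 ν,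
        Dense (Submodule.span ℂ (Set.range fun τ : L => (hk τ).toLp) :
          Set (MeasureTheory.Lp ℂ 2 ν)) := by
  have := hV.complete
  exact mainTheorem5_general S V (LinearFieldTheory.VacuumForm.imL hV) (fun _ _ => rfl)
    hV.bracket_surjective
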